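/- Let $n\ge 1$ and $N=2n-1$. On $\mathbb R^{2N}$ with coordinates $(q_1,\dots,q_N,p_1,\dots,p_N)$ put $q_0=q_{N+1}=0$, $u_i=e^{p_i+\frac12(q_{i+1}-q_{i-1})}$ for $1\le i\le N$, $u_i=0$ for all other $i$, and let $\Psi:\mathbb R^{2N}\to\mathbb R^{N}$, $\Psi(q,p)=(u_1,\dots,u_N)$, be Volterra's map. For a matrix field $J$ write $\{f,g\}_J=(\nabla f)^{T}J\nabla g$; $J$ is a Poisson tensor if it is smooth, skew-symmetric and its bracket satisfies the Jacobi identity. On $\mathbb R^N$ let $\pi_2$ be the quadratic bracket $\{u_i,u_{i+1}\}=u_iu_{i+1}$ and $\pi_3$ the cubic bracket $\{u_i,u_{i+1}\}=u_iu_{i+1}(u_i+u_{i+1})$, $\{u_i,u_{i+2}\}=u_iu_{i+1}u_{i+2}$ (all other brackets being zero). Let $L$ be the symmetric $(N+1)\times(N+1)$ matrix with diagonal entries $L_{kk}=u_{k-1}+u_k$, with $L_{k,k+2}=L_{k+2,k}=\sqrt{u_ku_{k+1}}$, and zeros elsewhere ($u_0=u_{N+1}=0$), and let $H_k=\frac1k\operatorname{Tr}L^k$.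 Put $$h_1=\sum_{i=1}^{N}e^{p_i+\frac12(q_{i+1}-q_{i-1})},\qquad h_2=\tfrac12\sum_{i=1}^{N}e^{2p_i+q_{i+1}-q_{i-1}}+\sum_{i=1}^{N-1}e^{p_i+p_{i+1}+\frac12(q_{i+2}+q_{i+1}-q_i-q_{i-1})}.$$ Let $J_2$ be the canonical bracket $\{q_i,p_j\}=\delta_{ij}$, and let $J_3$ be the skew-symmetric bracket given, for indices in $1,\dots,N$, by - $\{q_i,q_j\}=u_j$ for $i<j$; - $\{q_1,p_1\}=u_1+\frac12u_2$; $\{q_i,p_i\}=\frac12u_i+\frac12u_{i+1}$ for $i\ge2$; $\{q_i,p_{i+1}\}=\frac12u_{i+2}$; $\{q_i,p_j\}=-\frac12u_{j-1}+\frac12u_{j+1}$ for $j\ge i+2$; $\{q_2,p_1\}=u_2$; $\{q_i,p_{i-1}\}=\frac12u_i$ and $\{q_i,p_1\}=\frac12u_i$ for $i\ge3$; - $\{p_1,p_2\}=\frac12u_1+\frac14u_2-\frac14u_3$; $\{p_1,p_3\}=\frac12u_2-\frac14u_4$; $\{p_1,p_j\}=\frac14u_{j-1}-\frac14u_{j+1}$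 for $j\ge4$; $\{p_i,p_{i+1}\}=\frac14u_i+\frac14u_{i+1}$ and $\{p_i,p_{i+2}\}=\frac14u_{i+1}$ for $i\ge2$; all other brackets of coordinates being zero. Put $R=J_3J_2^{-1}$, $J_i=R^{i-2}J_2$ for $i\ge2$, $X_1=J_2\nabla h_1$ and $X_i=R^{i-1}X_1$ for $i\ge1$. Then: 1. $J_2$ is a symplectic (everywhere nondegenerate) Poisson tensor, $J_3$ is a Poisson tensor, and $J_2,J_3$ are compatible (all their linear combinations are Poisson). Under $\Psi$ the brackets $J_2$, $J_3$ map to $\pi_2$, $\pi_3$, that is, $\{F\circ\Psi,G\circ\Psi\}_{J_k}=\{F,G\}_{\pi_k}\circ\Psi$ for all smooth $F,G$ and $k=2,3$. Moreover $h_1=\frac12H_1\circ\Psi$ and $h_2=\frac12H_2\circ\Psi$. 2. $J_2\nabla h_2=J_3\nabla h_1$. 3. Every $J_i$, $i\ge2$, is a Poisson tensor, and $[X_i,X_j]=0$ for all $i,j\ge1$. 4. There are smooth functions $h_j$, $j\ge3$, on $\mathbb R^{2N}$ which together with the above $h_1,h_2$ satisfy $X_j=J_2\nabla h_j$ for $j\ge1$,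 $J_i\nabla h_j=X_{i+j-2}$ for $i\ge2$, $j\ge1$, and $\{h_i,h_j\}_{J_k}=0$ for all $i,j\ge1$, $k\ge2$. -/

import Mathlib

open scoped ContDiff Matrix

noncomputable section

namespace VolterraKM

/-! Poisson geometry on a coordinate space. A bivector field is given by its matrix of
coordinate brackets. -/

section General

variable {ι κ : Type} [Fintype ι] [DecidableEq ι] [Fintype κ] [DecidableEq κ]

/-- The vector of partial derivatives of `f` at `x`. -/
def grad (f : (ι → ℝ) → ℝ) (x : ι → ℝ) : ι → ℝ :=
  fun a => fderiv ℝ f x (Pi.single a 1)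

/-- The bracket `{f, g} = ∑ a b, (∂f/∂x_a) J_ab (∂g/∂x_b)`. -/
def bracket (J : (ι → ℝ) → Matrix ι ι ℝ) (f g : (ι → ℝ) → ℝ) (x : ι → ℝ) : ℝ :=
  grad f x ⬝ᵥ (J x *ᵥ grad g x)

/-- The Hamiltonian vector field `J ∇f`. -/
def hamField (J : (ι → ℝ) → Matrix ι ι ℝ) (f : (ι → ℝ) → ℝ) (x : ι → ℝ) : ι → ℝ :=
  J x *ᵥ grad f x

/-- A Poisson tensor: a smooth skew-symmetric matrix field whose bracket satisfies the
Jacobi identity on smooth functions. -/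
structure IsPoisson (J : (ι → ℝ) → Matrix ι ι ℝ) : Prop where
  smooth : ∀ a b, ContDiff ℝ ∞ (fun x => J x a b)
  skew : ∀ x a b, J x a b = -J x b a
  jacobi : ∀ f g h : (ι → ℝ) → ℝ, ContDiff ℝ ∞ f → ContDiff ℝ ∞ g → ContDiff ℝ ∞ h →
    ∀ x, bracket J f (bracket J g h) x + bracket J g (bracket J h f) x +
      bracket J h (bracket J f g) x = 0

/-- Two Poisson tensors are compatible: all their linear combinations are Poisson. -/
def Compatible (J K : (ι → ℝ) → Matrix ι ι ℝ) : Prop :=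
  ∀ a b : ℝ, IsPoisson (fun x => a • J x + b • K x)

/-- A symplectic Poisson tensor: a Poisson tensor that is nondegenerate at every point. -/
def IsSymplectic (J : (ι → ℝ) → Matrix ι ι ℝ) : Prop :=
  IsPoisson J ∧ ∀ x, IsUnit (J x)

/-- The map `Φ` sends the bivector field `J` to the bivector field `π`. -/
def MapsTensor (Φ : (ι → ℝ) → (κ → ℝ)) (J : (ι → ℝ) → Matrix ι ι ℝ)
    (π : (κ → ℝ) → Matrix κ κ ℝ) : Prop :=
  ∀ F G : (κ → ℝ) → ℝ, ContDiff ℝ ∞ F → ContDiff ℝ ∞ G →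
    ∀ x, bracket J (F ∘ Φ) (G ∘ Φ) x = bracket π F G (Φ x)

end General

variable {N : ℕ}

/-- One-based components of `v`, extended by `v_i = 0` for `i` outside `1, …, N`. -/
def comp (v : Fin N → ℝ) (i : ℕ) : ℝ :=
  if h : 1 ≤ i ∧ i ≤ N then v ⟨i - 1, by omega⟩ else 0

/-! The KM-system in the variables `u_1, …, u_N`. -/

/-- The matrix `(m i j)`, `1 ≤ i, j ≤ N` (one-based), that is skew-symmetric and whose entries
above the diagonal are given by `m`. -/
def skewOf (N : ℕ) (m : ℕ → ℕ → ℝ) : Matrix (Fin N) (Fin N) ℝ :=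
  Matrix.of fun i j =>
    if i < j then m (i + 1) (j + 1) else if j < i then -m (j + 1) (i + 1) else 0

/-- The quadratic bracket `{u_i, u_{i+1}} = u_i u_{i+1}`. -/
def pi2 (u : Fin N → ℝ) : Matrix (Fin N) (Fin N) ℝ :=
  skewOf N fun i j => if j = i + 1 then comp u i * comp u j else 0

/-- The cubic bracket `{u_i, u_{i+1}} = u_i u_{i+1} (u_i + u_{i+1})`,
`{u_i, u_{i+2}} = u_i u_{i+1} u_{i+2}`. -/
def pi3 (u : Fin N → ℝ) : Matrix (Fin N) (Fin N) ℝ :=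
  skewOf N fun i j =>
    if j = i + 1 then comp u i * comp u j * (comp u i + comp u j)
    else if j = i + 2 then comp u i * comp u (i + 1) * comp u j
    else 0

/-- The symmetric Lax matrix of size `N + 1`: in one-based indices its diagonal entries are
`u_{k-1} + u_k`, and its entries at `(k, k+2)` and `(k+2, k)` are `√(u_k u_{k+1})`. -/
def lax (u : Fin N → ℝ) : Matrix (Fin (N + 1)) (Fin (N + 1)) ℝ :=
  Matrix.of fun i j =>
    if i = j then comp u i + comp u (i + 1)
    else if (j : ℕ) = i + 2 then √(comp u (i + 1) * comp u (i + 2))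
    else if (i : ℕ) = j + 2 then √(comp u (j + 1) * comp u (j + 2))
    else 0

/-- `H_k = (1/k) Tr L^k`. -/
def traceH (k : ℕ) (u : Fin N → ℝ) : ℝ :=
  (1 / (k : ℝ)) * (lax u ^ k).trace

/-! The symplectic space with coordinates `(q, p)`; `Sum.inl i` is the index of `q`,
`Sum.inr i` that of `p`. -/

/-- The phase space `ℝ^{2N}`. -/
abbrev Phase (N : ℕ) := Fin N ⊕ Fin N → ℝ

/-- `q_i`, one-based, with `q_0 = q_{N+1} = 0`. -/
def q (x : Phase N) (i : ℕ) : ℝ := comp (fun k => x (Sum.inl k)) i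

/-- `p_i`, one-based. -/
def p (x : Phase N) (i : ℕ) : ℝ := comp (fun k => x (Sum.inr k)) i

/-- Volterra's map `u_i = exp (p_i + (q_{i+1} - q_{i-1}) / 2)`. -/
def volterra (x : Phase N) : Fin N → ℝ :=
  fun k => Real.exp (p x (k + 1) + (1 / 2) * (q x (k + 2) - q x k))

/-- `u_i` as a function on phase space, one-based, with `u_0 = u_{N+1} = 0`. -/
def uu (x : Phase N) (i : ℕ) : ℝ := comp (volterra x) i

/-- The Hamiltonian `h_1`. -/
def h1 (x : Phase N) : ℝ :=
  ∑ i ∈ Finset.Icc 1 N, Real.exp (p x i + (1 / 2) * (q x (i + 1) - q x (i - 1)))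

/-- The Hamiltonian `h_2`. -/
def h2 (x : Phase N) : ℝ :=
  (1 / 2) * ∑ i ∈ Finset.Icc 1 N, Real.exp (2 * p x i + q x (i + 1) - q x (i - 1)) +
    ∑ i ∈ Finset.Icc 1 (N - 1), Real.exp (p x i + p x (i + 1) +
      (1 / 2) * (q x (i + 2) + q x (i + 1) - q x i - q x (i - 1)))

/-- The canonical bracket, `{q_i, p_j} = δ_ij`. -/
def J2 (_ : Phase N) : Matrix (Fin N ⊕ Fin N) (Fin N ⊕ Fin N) ℝ :=
  Matrix.fromBlocks 0 1 (-1) 0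

/-- The brackets `{q_i, p_j}` of the second structure. -/
def qp3 (x : Phase N) (i j : ℕ) : ℝ :=
  if i = j then
    if i = 1 then uu x 1 + (1 / 2) * uu x 2 else (1 / 2) * uu x i + (1 / 2) * uu x (i + 1)
  else if j = i + 1 then (1 / 2) * uu x (i + 2)
  else if i + 2 ≤ j then -(1 / 2) * uu x (j - 1) + (1 / 2) * uu x (j + 1)
  else if j = 1 then if i = 2 then uu x 2 else (1 / 2) * uu x i
  else if i = j + 1 then (1 / 2) * uu x i
  else 0

/-- The brackets `{p_i, p_j}`, `i < j`, of the second structure. -/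
def pp3 (x : Phase N) (i j : ℕ) : ℝ :=
  if i = 1 then
    if j = 2 then (1 / 2) * uu x 1 + (1 / 4) * uu x 2 - (1 / 4) * uu x 3
    else if j = 3 then (1 / 2) * uu x 2 - (1 / 4) * uu x 4
    else -(1 / 4) * uu x (j + 1) + (1 / 4) * uu x (j - 1)
  else if j = i + 1 then (1 / 4) * uu x i + (1 / 4) * uu x (i + 1)
  else if j = i + 2 then (1 / 4) * uu x (i + 1)
  else 0

/-- The second structure: `{q_i, q_j} = u_j` for `i < j`, and `{q_i, p_j}`, `{p_i, p_j}`
as above. -/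
def J3 (x : Phase N) : Matrix (Fin N ⊕ Fin N) (Fin N ⊕ Fin N) ℝ :=
  Matrix.fromBlocks
    (skewOf N fun _ j => uu x j)
    (Matrix.of fun i j => qp3 x (i + 1) (j + 1))
    (Matrix.of fun i j => -qp3 x (j + 1) (i + 1))
    (skewOf N fun i j => pp3 x i j)

/-- The recursion operator `R = J_3 J_2⁻¹`. -/
def recOp (x : Phase N) : Matrix (Fin N ⊕ Fin N) (Fin N ⊕ Fin N) ℝ :=
  J3 x * (J2 x)⁻¹

/-- `J_i = R^{i-2} J_2`, for `i ≥ 2`. -/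
def tensorJ (i : ℕ) (x : Phase N) : Matrix (Fin N ⊕ Fin N) (Fin N ⊕ Fin N) ℝ :=
  recOp x ^ (i - 2) * J2 x

/-- `X_i = R^{i-1} X_1`, for `i ≥ 1`, where `X_1 = J_2 ∇h_1`. -/
def fieldX (i : ℕ) (x : Phase N) : Phase N :=
  recOp x ^ (i - 1) *ᵥ hamField J2 h1 x

end VolterraKM

end

/-! Both tensors become simple in terms of constant vector fields ξ_0, …, ξ_N. The functions ℓ_k =
log u_{k+1} are linear in (q, p), J_2 dℓ_k = ξ_{k+1} - ξ_k (`ell_J2`), the field ξ_d has derivative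
-1 on log u_d and log u_{d+1} and 0 on the other logarithms (`ell_xi`), and J_3 = ∑ u_{k+1} ξ_k ∧
ξ_{k+1} (`J3_eq`). The mixed Jacobi identity then holds term by term, because (ξ_k - ξ_{k+1}) ∧ ξ_k
∧ ξ_{k+1} = 0, and the Jacobi sum of J_3 telescopes through the trivectors u_k u_{k+1} ξ_{k-1} ∧ ξ_k
∧ ξ_{k+1}. The same relations yield the images under Ψ and J_2 ∇h_2 = J_3 ∇h_1.

The hierarchy is general bi-Hamiltonian theory over the constant symplectic tensor J_2, with K its
inverse. The mixed identity says that the two-form of K R is closed; given this, the Jacobi identity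
of J_3 = R J_2 is the vanishing of the Nijenhuis torsion of R (`jacobi_sum_eq`). Powers of R remain
torsion-free with closed forms, so every R^k J_2 is Poisson.

Vanishing torsion also makes the traces of R^j a Lenard chain (`trace_pow_mul_dmat`). Since Tr R = 2
h_1, the functions Tr R^j / (2j) generate the X_j. Involution follows because K R^m is alternating,
and commutativity of the fields follows from involution for J_2. -/

open scoped ContDiff Matrix

noncomputable section

namespace VolterraKM

/-! ### Calculus of matrix fields, Jacobi identity, torsion -/

section Theory

set_option linter.unusedSectionVars false

variable {ι κ : Type} [Fintype ι] [DecidableEq ι] [Fintype κ] [DecidableEq κ]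

/-- A matrix field with smooth entries. -/
def SmoothMat (A : (ι → ℝ) → Matrix κ κ ℝ) : Prop :=
  ∀ a b, ContDiff ℝ ∞ (fun x => A x a b)

/-- The entrywise derivative of a matrix field at `x` in the direction `v`. -/
def dmat (A : (ι → ℝ) → Matrix κ κ ℝ) (x v : ι → ℝ) : Matrix κ κ ℝ :=
  Matrix.of fun a b => fderiv ℝ (fun y => A y a b) x v

theorem SmoothMat.differentiableAt {A : (ι → ℝ) → Matrix κ κ ℝ} (hA : SmoothMat A) (a b : κ)
    (x : ι → ℝ) : DifferentiableAt ℝ (fun y => A y a b) x :=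
  ((hA a b).differentiable (by simp)).differentiableAt

theorem smoothMat_const (K : Matrix κ κ ℝ) : SmoothMat (fun _ : ι → ℝ => K) :=
  fun _ _ => contDiff_const

theorem SmoothMat.mul {A B : (ι → ℝ) → Matrix κ κ ℝ} (hA : SmoothMat A) (hB : SmoothMat B) :
    SmoothMat (fun x => A x * B x) := by
  intro a b
  simp only [Matrix.mul_apply]
  exact ContDiff.sum fun c _ => (hA a c).mul (hB c b)

theorem SmoothMat.pow {A : (ι → ℝ) → Matrix κ κ ℝ} (hA : SmoothMat A) (k : ℕ) :
    SmoothMat (fun x => A x ^ k) := by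
  induction k with
  | zero => simpa using smoothMat_const (1 : Matrix κ κ ℝ)
  | succ k ih => simpa only [pow_succ] using ih.mul hA

theorem dmat_mul {A B : (ι → ℝ) → Matrix κ κ ℝ} (hA : SmoothMat A) (hB : SmoothMat B)
    (x v : ι → ℝ) :
    dmat (fun y => A y * B y) x v = dmat A x v * B x + A x * dmat B x v := by
  ext a b
  simp only [dmat, Matrix.of_apply, Matrix.add_apply, Matrix.mul_apply]
  rw [fderiv_fun_sum fun c _ => (hA.differentiableAt a c x).fun_mul (hB.differentiableAt c b x)]
  rw [_root_.sum_apply, ← Finset.sum_add_distrib]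
  refine Finset.sum_congr rfl fun c _ => ?_
  rw [fderiv_fun_mul (hA.differentiableAt a c x) (hB.differentiableAt c b x)]
  simp
  ring

theorem dmat_const (K : Matrix κ κ ℝ) (x v : ι → ℝ) : dmat (fun _ => K) x v = 0 := by
  ext a b
  simp [dmat]

theorem dmat_mul_const {A : (ι → ℝ) → Matrix κ κ ℝ} (hA : SmoothMat A) (K : Matrix κ κ ℝ)
    (x v : ι → ℝ) : dmat (fun y => A y * K) x v = dmat A x v * K := by
  rw [dmat_mul hA (smoothMat_const K), dmat_const]
  simp

theorem dmat_const_mul {A : (ι → ℝ) → Matrix κ κ ℝ} (hA : SmoothMat A) (K : Matrix κ κ ℝ)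
    (x v : ι → ℝ) : dmat (fun y => K * A y) x v = K * dmat A x v := by
  rw [dmat_mul (smoothMat_const K) hA, dmat_const]
  simp

theorem fderiv_apply_eq_dotProduct (f : (ι → ℝ) → ℝ) (x v : ι → ℝ) :
    fderiv ℝ f x v = grad f x ⬝ᵥ v := by
  conv_lhs => rw [pi_eq_sum_univ' v]
  simp only [map_sum, map_smul, smul_eq_mul, dotProduct, grad]
  exact Finset.sum_congr rfl fun a _ => mul_comm _ _

theorem contDiff_grad {f : (ι → ℝ) → ℝ} (hf : ContDiff ℝ ∞ f) (a : ι) :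
    ContDiff ℝ ∞ (fun x => grad f x a) :=
  (hf.fderiv_right (m := ∞) (by simp)).clm_apply contDiff_const

theorem fderiv_grad {f : (ι → ℝ) → ℝ} (hf : ContDiff ℝ ∞ f) (x v : ι → ℝ) (a : ι) :
    fderiv ℝ (fun y => grad f y a) x v = fderiv ℝ (fderiv ℝ f) x v (Pi.single a 1) := by
  have hd : DifferentiableAt ℝ (fderiv ℝ f) x :=
    ((hf.fderiv_right (m := ∞) (by simp)).differentiable (by simp)).differentiableAt
  simp only [grad]
  rw [fderiv_clm_apply hd (differentiableAt_const _)]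
  simp

/-- The Hessian form of `f`. -/
def hess (f : (ι → ℝ) → ℝ) (x v w : ι → ℝ) : ℝ := fderiv ℝ (fderiv ℝ f) x v w

theorem hess_symm {f : (ι → ℝ) → ℝ} (hf : ContDiff ℝ ∞ f) (x v w : ι → ℝ) :
    hess f x v w = hess f x w v :=
  (hf.contDiffAt.isSymmSndFDerivAt (by simpa using ENat.LEInfty.out)) v w

theorem sum_fderiv_grad_mul {f : (ι → ℝ) → ℝ} (hf : ContDiff ℝ ∞ f) (x v w : ι → ℝ) :
    ∑ a, fderiv ℝ (fun y => grad f y a) x v * w a = hess f x v w := by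
  simp only [fderiv_grad hf, hess]
  conv_rhs => rw [pi_eq_sum_univ' w]
  simp only [map_sum, map_smul, smul_eq_mul]
  exact Finset.sum_congr rfl fun a _ => mul_comm _ _

theorem dotProduct_mulVec_skew {M : Matrix ι ι ℝ} (hM : ∀ a b, M a b = -M b a) (v w : ι → ℝ) :
    v ⬝ᵥ (M *ᵥ w) = -((M *ᵥ v) ⬝ᵥ w) := by
  have h : Mᵀ = -M := by ext a b; simpa using hM b a
  rw [Matrix.dotProduct_mulVec, ← Matrix.mulVec_transpose, h, Matrix.neg_mulVec, neg_dotProduct]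

theorem fderiv_bracket {J : (ι → ℝ) → Matrix ι ι ℝ} (hJ : SmoothMat J)
    (hs : ∀ x a b, J x a b = -J x b a) {f g : (ι → ℝ) → ℝ}
    (hf : ContDiff ℝ ∞ f) (hg : ContDiff ℝ ∞ g) (x v : ι → ℝ) :
    fderiv ℝ (bracket J f g) x v =
      hess f x v (J x *ᵥ grad g x) - hess g x v (J x *ᵥ grad f x) +
        grad f x ⬝ᵥ (dmat J x v *ᵥ grad g x) := by
  have df : ∀ a, DifferentiableAt ℝ (fun y => grad f y a) x := fun a =>
    ((contDiff_grad hf a).differentiable (by simp)).differentiableAt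
  have dg : ∀ a, DifferentiableAt ℝ (fun y => grad g y a) x := fun a =>
    ((contDiff_grad hg a).differentiable (by simp)).differentiableAt
  have dJ := fun a b => hJ.differentiableAt a b x
  have e1 : hess g x v (J x *ᵥ grad f x) =
      -∑ a, grad f x a * ∑ b, J x a b * fderiv ℝ (fun y => grad g y b) x v := by
    rw [← sum_fderiv_grad_mul hg]
    have := dotProduct_mulVec_skew (hs x) (grad f x) (fun b => fderiv ℝ (fun y => grad g y b) x v)
    simp only [dotProduct, Matrix.mulVec] at this
    rw [this, neg_neg]
    exact Finset.sum_congr rfl fun a _ => mul_comm _ _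
  rw [e1, ← sum_fderiv_grad_mul hf, sub_neg_eq_add]
  unfold bracket
  simp only [dotProduct, Matrix.mulVec, dmat, Matrix.of_apply]
  rw [fderiv_fun_sum fun a _ => (df a).fun_mul
    (DifferentiableAt.fun_sum fun b _ => (dJ a b).fun_mul (dg b))]
  rw [_root_.sum_apply, ← Finset.sum_add_distrib, ← Finset.sum_add_distrib]
  refine Finset.sum_congr rfl fun a _ => ?_
  rw [fderiv_fun_mul (df a) (DifferentiableAt.fun_sum fun b _ => (dJ a b).fun_mul (dg b))]
  rw [fderiv_fun_sum fun b _ => (dJ a b).fun_mul (dg b)]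
  simp only [_root_.add_apply, _root_.smul_apply, smul_eq_mul,
    _root_.sum_apply]
  have e2 : ∑ b, fderiv ℝ (fun y => J y a b * grad g y b) x v =
      ∑ b, J x a b * fderiv ℝ (fun y => grad g y b) x v +
        ∑ b, grad g x b * fderiv ℝ (fun y => J y a b) x v := by
    rw [← Finset.sum_add_distrib]
    refine Finset.sum_congr rfl fun b _ => ?_
    rw [fderiv_fun_mul (dJ a b) (dg b)]
    rfl
  rw [e2]
  have : ∑ b, grad g x b * fderiv ℝ (fun y => J y a b) x v =
      ∑ b, fderiv ℝ (fun y => J y a b) x v * grad g x b :=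
    Finset.sum_congr rfl fun b _ => mul_comm _ _
  rw [this]
  ring

/-- The Jacobi identity of the matrix field `J`, tested on constant covectors. -/
def JacobiId (J : (ι → ℝ) → Matrix ι ι ℝ) : Prop :=
  ∀ x α β γ, γ ⬝ᵥ (dmat J x (J x *ᵥ α) *ᵥ β) + α ⬝ᵥ (dmat J x (J x *ᵥ β) *ᵥ γ) +
    β ⬝ᵥ (dmat J x (J x *ᵥ γ) *ᵥ α) = 0

theorem dmat_skew {J : (ι → ℝ) → Matrix ι ι ℝ} (hs : ∀ x a b, J x a b = -J x b a)
    (x v : ι → ℝ) (a b : ι) : dmat J x v a b = -dmat J x v b a := by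
  simp only [dmat, Matrix.of_apply]
  rw [show (fun y => J y a b) = fun y => -J y b a from funext fun y => hs y a b, fderiv_fun_neg]
  rfl

/-- In the cyclic sum of double brackets all second derivatives of f, g, h cancel in pairs by
symmetry of the Hessians. What remains involves only first derivatives of J, with the gradients
entering as fixed covectors. -/
theorem isPoisson_of_jacobiId {J : (ι → ℝ) → Matrix ι ι ℝ} (hJ : SmoothMat J)
    (hs : ∀ x a b, J x a b = -J x b a) (hj : JacobiId J) : IsPoisson J := by
  refine ⟨hJ, hs, fun f g h hf hg hh x => ?_⟩
  have key : ∀ f g h : (ι → ℝ) → ℝ, ContDiff ℝ ∞ f → ContDiff ℝ ∞ g → ContDiff ℝ ∞ h →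
      bracket J f (bracket J g h) x =
        -(hess g x (J x *ᵥ grad f x) (J x *ᵥ grad h x) -
          hess h x (J x *ᵥ grad f x) (J x *ᵥ grad g x) +
          grad g x ⬝ᵥ (dmat J x (J x *ᵥ grad f x) *ᵥ grad h x)) := by
    intro f g h hf hg hh
    rw [← fderiv_bracket hJ hs hg hh, fderiv_apply_eq_dotProduct]
    conv_lhs => unfold bracket
    rw [dotProduct_mulVec_skew (hs x), dotProduct_comm]
    rfl
  rw [key f g h hf hg hh, key g h f hg hh hf, key h f g hh hf hg]
  have e := hj x (grad f x) (grad g x) (grad h x)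
  have s1 := dotProduct_mulVec_skew (dmat_skew hs x (J x *ᵥ grad f x)) (grad g x) (grad h x)
  have s2 := dotProduct_mulVec_skew (dmat_skew hs x (J x *ᵥ grad g x)) (grad h x) (grad f x)
  have s3 := dotProduct_mulVec_skew (dmat_skew hs x (J x *ᵥ grad h x)) (grad f x) (grad g x)
  rw [dotProduct_comm] at s1 s2 s3
  rw [dotProduct_comm (dmat J x _ *ᵥ grad g x)] at s1
  rw [dotProduct_comm (dmat J x _ *ᵥ grad h x)] at s2
  rw [dotProduct_comm (dmat J x _ *ᵥ grad f x)] at s3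
  rw [dotProduct_comm] at s1 s2 s3
  rw [hess_symm hf x (J x *ᵥ grad g x), hess_symm hg x (J x *ᵥ grad f x),
    hess_symm hh x (J x *ᵥ grad f x)]
  linarith

/-! Recursion operators -/

/-- The concomitant of two matrix fields; for `A = B` it is the Nijenhuis torsion. -/
def torsion (A B : (ι → ℝ) → Matrix ι ι ℝ) (x v w : ι → ℝ) : ι → ℝ :=
  dmat B x (A x *ᵥ v) *ᵥ w - dmat A x (B x *ᵥ w) *ᵥ v + B x *ᵥ (dmat A x w *ᵥ v) -
    A x *ᵥ (dmat B x v *ᵥ w)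

theorem torsion_swap (A B : (ι → ℝ) → Matrix ι ι ℝ) (x v w : ι → ℝ) :
    torsion A B x v w = -torsion B A x w v := by
  unfold torsion
  abel

/-- For constant v, w the concomitant is [Av, Bw] - A[v, Bw] - B[Av, w] + AB[v, w], so it obeys a
Leibniz rule in A once A commutes with B. This allows induction on powers. -/
theorem torsion_mul {A A' B : (ι → ℝ) → Matrix ι ι ℝ} (hA : SmoothMat A) (hA' : SmoothMat A')
    (hc : ∀ x, A x * B x = B x * A x) (x v w : ι → ℝ) :
    torsion (fun y => A y * A' y) B x v w =
      torsion A B x (A' x *ᵥ v) w + A x *ᵥ torsion A' B x v w := by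
  unfold torsion
  rw [dmat_mul hA hA', dmat_mul hA hA']
  simp only [Matrix.add_mulVec, Matrix.mulVec_add, Matrix.mulVec_sub, Matrix.mulVec_mulVec,
    ← Matrix.mul_assoc, hc x]
  abel

theorem torsion_one (B : (ι → ℝ) → Matrix ι ι ℝ) (x v w : ι → ℝ) :
    torsion (fun _ => 1) B x v w = 0 := by
  simp [torsion, dmat_const]

theorem torsion_pow_left {R B : (ι → ℝ) → Matrix ι ι ℝ} (hR : SmoothMat R)
    (hc : ∀ x, R x * B x = B x * R x) (hT : ∀ x v w, torsion R B x v w = 0) (k : ℕ)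
    (x v w : ι → ℝ) : torsion (fun y => R y ^ k) B x v w = 0 := by
  induction k generalizing v w with
  | zero => simpa using torsion_one B x v w
  | succ k ih =>
    simp only [pow_succ']
    rw [torsion_mul hR (hR.pow k) hc, hT, ih]
    simp

theorem torsion_pow_pow {R : (ι → ℝ) → Matrix ι ι ℝ} (hR : SmoothMat R)
    (hT : ∀ x v w, torsion R R x v w = 0) (j k : ℕ) (x v w : ι → ℝ) :
    torsion (fun y => R y ^ j) (fun y => R y ^ k) x v w = 0 := by
  refine torsion_pow_left hR (fun x => ((Commute.refl (R x)).pow_right k).eq) (fun x v w => ?_)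
    j x v w
  rw [torsion_swap, torsion_pow_left hR (fun _ => rfl) hT, neg_zero]

/-- Closedness of the two-form `(c, b) ↦ K c ⬝ A b`. -/
def ClosedForm (K : Matrix ι ι ℝ) (A : (ι → ℝ) → Matrix ι ι ℝ) : Prop :=
  ∀ x a b c, (K *ᵥ c) ⬝ᵥ (dmat A x a *ᵥ b) + (K *ᵥ a) ⬝ᵥ (dmat A x b *ᵥ c) +
    (K *ᵥ b) ⬝ᵥ (dmat A x c *ᵥ a) = 0

theorem form_symm {K M : Matrix ι ι ℝ} (hM : K * M = Mᵀ * K) (b c : ι → ℝ) :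
    (K *ᵥ c) ⬝ᵥ (M *ᵥ b) = (K *ᵥ (M *ᵥ c)) ⬝ᵥ b := by
  rw [Matrix.mulVec_mulVec, hM, Matrix.dotProduct_mulVec, ← Matrix.mulVec_transpose,
    Matrix.mulVec_mulVec]

theorem form_antisymm {K : Matrix ι ι ℝ} (hK : Kᵀ = -K) (b c : ι → ℝ) :
    (K *ᵥ c) ⬝ᵥ b = -((K *ᵥ b) ⬝ᵥ c) := by
  rw [dotProduct_comm, Matrix.dotProduct_mulVec, ← Matrix.mulVec_transpose, hK,
    Matrix.neg_mulVec, neg_dotProduct]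

theorem dmat_symm {K : Matrix ι ι ℝ} {A : (ι → ℝ) → Matrix ι ι ℝ} (hA : SmoothMat A)
    (h : ∀ x, K * A x = (A x)ᵀ * K) (x v : ι → ℝ) :
    K * dmat A x v = (dmat A x v)ᵀ * K := by
  rw [← dmat_const_mul hA, show (fun y => K * A y) = fun y => (A y)ᵀ * K from funext h,
    dmat_mul_const (A := fun y => (A y)ᵀ) (fun a b => hA b a)]
  rfl

/-- The exterior derivative of the form of AB is a combination of those of A and B, one argument
being moved by A or B, of the torsion, and of the derivative of the relation AB = BA. -/
theorem ClosedForm.mul {K : Matrix ι ι ℝ} (hK : Kᵀ = -K) {A B : (ι → ℝ) → Matrix ι ι ℝ}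
    (hA : SmoothMat A) (hB : SmoothMat B) (sA : ∀ x, K * A x = (A x)ᵀ * K)
    (sB : ∀ x, K * B x = (B x)ᵀ * K) (hc : ∀ x, A x * B x = B x * A x)
    (hT : ∀ x v w, torsion A B x v w = 0) (cA : ClosedForm K A) (cB : ClosedForm K B) :
    ClosedForm K (fun y => A y * B y) := by
  intro x a b c
  have dA := dmat_symm hA sA
  have dB := dmat_symm hB sB
  have t := congrArg (fun z => (K *ᵥ c) ⬝ᵥ z) (hT x a b)
  simp only [torsion, dotProduct_add, dotProduct_sub, dotProduct_zero] at t
  -- The relation AB = BA, differentiated in direction c.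
  have e := congrArg (fun M => (K *ᵥ b) ⬝ᵥ (M *ᵥ a))
    ((dmat_mul hA hB x c).symm.trans ((congrArg (fun F => dmat F x c) (funext hc)).trans
      (dmat_mul hB hA x c)))
  simp only [dmat_mul hA hB]
  have c1 := cB x (A x *ᵥ a) b c
  have c2 := cA x (B x *ᵥ b) a c
  simp only [Matrix.add_mulVec, dotProduct_add, ← Matrix.mulVec_mulVec] at e ⊢
  have anti : ∀ {F : (ι → ℝ) → Matrix ι ι ℝ} (_ : ∀ v, K * dmat F x v = (dmat F x v)ᵀ * K)
      (v y z : ι → ℝ), (K *ᵥ y) ⬝ᵥ (dmat F x v *ᵥ z) = -((K *ᵥ z) ⬝ᵥ (dmat F x v *ᵥ y)) := by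
    intro F hF v y z
    rw [form_symm (hF v), form_antisymm hK]
  simp only [form_symm (sA x), form_symm (sB x)] at *
  have q1 := anti (dA x) a (B x *ᵥ b) c
  have q2 := anti (dA x) b (B x *ᵥ c) a
  have q3 := anti (dA x) c (B x *ᵥ b) a
  have q4 := anti (dA x) c (B x *ᵥ a) b
  have q5 := anti (dB x) c b (A x *ᵥ a)
  linarith

theorem ClosedForm.pow {K : Matrix ι ι ℝ} (hK : Kᵀ = -K) {R : (ι → ℝ) → Matrix ι ι ℝ}
    (hR : SmoothMat R) (sR : ∀ x, K * R x = (R x)ᵀ * K)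
    (hT : ∀ x v w, torsion R R x v w = 0) (cR : ClosedForm K R) (k : ℕ) :
    ClosedForm K (fun y => R y ^ k) := by
  induction k with
  | zero => intro x a b c; simp [dmat_const]
  | succ k ih =>
    simp only [pow_succ]
    refine ClosedForm.mul hK (hR.pow k) hR (fun x => ?_) sR
      (fun x => ((Commute.refl (R x)).pow_left k).eq)
      (torsion_pow_left hR (fun _ => rfl) hT k) ih cR
    rw [Matrix.transpose_pow]
    exact (SemiconjBy.pow_right (show SemiconjBy K (R x) (R x)ᵀ from sR x) k)

/-- The Jacobi identity for `A P`, where `P` is constant with inverse `K`, amounts to the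
vanishing of the torsion of `A`, if the form of `A` is closed. -/
theorem jacobi_sum_eq {K P : Matrix ι ι ℝ} (hK : Kᵀ = -K) (hKP : K * P = 1)
    {A : (ι → ℝ) → Matrix ι ι ℝ} (hA : SmoothMat A) (sA : ∀ x, K * A x = (A x)ᵀ * K)
    (cA : ClosedForm K A) (x α β γ : ι → ℝ) :
    γ ⬝ᵥ (dmat (fun y => A y * P) x ((A x * P) *ᵥ α) *ᵥ β) +
      α ⬝ᵥ (dmat (fun y => A y * P) x ((A x * P) *ᵥ β) *ᵥ γ) +
      β ⬝ᵥ (dmat (fun y => A y * P) x ((A x * P) *ᵥ γ) *ᵥ α) =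
    γ ⬝ᵥ torsion A A x (P *ᵥ α) (P *ᵥ β) := by
  have back : ∀ δ : ι → ℝ, δ = K *ᵥ (P *ᵥ δ) := fun δ => by
    rw [Matrix.mulVec_mulVec, hKP, Matrix.one_mulVec]
  simp only [dmat_mul_const hA, ← Matrix.mulVec_mulVec, torsion]
  generalize ha : P *ᵥ α = a
  generalize hb : P *ᵥ β = b
  generalize hc : P *ᵥ γ = c
  rw [back α, back β, back γ, ha, hb, hc]
  have dA := dmat_symm hA sA
  -- Closedness at (a, b, A c) turns the two torsion terms with A outermost into the derivative in
  -- direction A c.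
  have h1 := cA x a b (A x *ᵥ c)
  simp only [dotProduct_add, dotProduct_sub]
  simp only [form_symm (sA x)]
  have anti : ∀ v y z : ι → ℝ,
      (K *ᵥ y) ⬝ᵥ (dmat A x v *ᵥ z) = -((K *ᵥ z) ⬝ᵥ (dmat A x v *ᵥ y)) := by
    intro v y z
    rw [form_symm (dA x v), form_antisymm hK]
  have q1 := anti (A x *ᵥ b) a c
  have q2 := anti b a (A x *ᵥ c)
  linarith

/-- A constant symplectic tensor and a compatible Poisson tensor have a torsion-free recursion
operator. -/
theorem torsion_eq_zero_of_jacobiId {K P : Matrix ι ι ℝ} (hK : Kᵀ = -K) (hKP : K * P = 1)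
    {A : (ι → ℝ) → Matrix ι ι ℝ} (hA : SmoothMat A) (sA : ∀ x, K * A x = (A x)ᵀ * K)
    (cA : ClosedForm K A) (hj : JacobiId (fun y => A y * P)) (x v w : ι → ℝ) :
    torsion A A x v w = 0 := by
  have hPK : P * K = 1 := mul_eq_one_comm.mp hKP
  have back : ∀ δ : ι → ℝ, P *ᵥ (K *ᵥ δ) = δ := fun δ => by
    rw [Matrix.mulVec_mulVec, hPK, Matrix.one_mulVec]
  refine dotProduct_eq_zero_iff.mp fun γ => ?_
  have h := jacobi_sum_eq hK hKP hA sA cA x (K *ᵥ v) (K *ᵥ w) γ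
  rw [back, back, hj x] at h
  rw [dotProduct_comm]
  exact h.symm

theorem isPoisson_pow_mul {K P : Matrix ι ι ℝ} (hK : Kᵀ = -K) (hKP : K * P = 1)
    {R : (ι → ℝ) → Matrix ι ι ℝ} (hR : SmoothMat R) (sR : ∀ x, K * R x = (R x)ᵀ * K)
    (cR : ClosedForm K R) (hT : ∀ x v w, torsion R R x v w = 0) (k : ℕ) :
    IsPoisson (fun y => R y ^ k * P) := by
  have hPK : P * K = 1 := mul_eq_one_comm.mp hKP
  have sk : ∀ x, K * R x ^ k = (R x ^ k)ᵀ * K := fun x => by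
    rw [Matrix.transpose_pow]
    exact (SemiconjBy.pow_right (show SemiconjBy K (R x) (R x)ᵀ from sR x) k)
  have hP : Pᵀ = -P := by
    have h1 : Kᵀ * Pᵀ = 1 := by rw [← Matrix.transpose_mul, hPK, Matrix.transpose_one]
    rw [hK] at h1
    calc Pᵀ = (P * K) * Pᵀ := by rw [hPK, one_mul]
      _ = -(P * (-K * Pᵀ)) := by simp [Matrix.mul_assoc]
      _ = -P := by rw [h1, mul_one]
  refine isPoisson_of_jacobiId ((hR.pow k).mul (smoothMat_const P)) (fun x a b => ?_) ?_
  · have : (R x ^ k * P)ᵀ = -(R x ^ k * P) := by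
      have h2 : P * (R x ^ k)ᵀ = R x ^ k * P := by
        calc P * (R x ^ k)ᵀ = P * ((R x ^ k)ᵀ * K) * P := by
              rw [Matrix.mul_assoc, Matrix.mul_assoc, hKP, mul_one]
          _ = R x ^ k * P := by rw [← sk x, ← Matrix.mul_assoc, hPK, one_mul]
      rw [Matrix.transpose_mul, hP, Matrix.neg_mul, h2]
    have h3 := congrFun (congrFun this b) a
    simpa using h3
  · intro x α β γ
    rw [jacobi_sum_eq hK hKP (hR.pow k) sk (ClosedForm.pow hK hR sR hT cR k),
      torsion_pow_pow hR hT, dotProduct_zero]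

/-! ### Traces of powers, commuting Hamiltonian fields, images of tensors -/

theorem fderiv_trace_pow {R : (ι → ℝ) → Matrix ι ι ℝ} (hR : SmoothMat R) (k : ℕ)
    (x v : ι → ℝ) :
    fderiv ℝ (fun y => (R y ^ k).trace) x v = k * (R x ^ (k - 1) * dmat R x v).trace := by
  have h0 : ∀ {A : (ι → ℝ) → Matrix ι ι ℝ}, SmoothMat A →
      fderiv ℝ (fun y => (A y).trace) x v = (dmat A x v).trace := by
    intro A hA
    simp only [Matrix.trace, Matrix.diag]
    rw [fderiv_fun_sum fun a _ => hA.differentiableAt a a x, _root_.sum_apply]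
    rfl
  rw [h0 (hR.pow k)]
  -- The induction needs a commuting factor B: cyclicity of the trace moves each split-off R into B.
  have h1 : ∀ (k : ℕ) (B : Matrix ι ι ℝ), Commute B (R x) →
      (B * dmat (fun y => R y ^ (k + 1)) x v).trace =
        (k + 1) * (B * R x ^ k * dmat R x v).trace := by
    intro k
    induction k with
    | zero => intro B _; simp
    | succ k ih =>
      intro B hB
      have := dmat_mul (hR.pow (k + 1)) hR x v
      simp only [← pow_succ] at this
      rw [this, mul_add, Matrix.trace_add, ← Matrix.mul_assoc, ← Matrix.mul_assoc,
        Matrix.trace_mul_comm, ← Matrix.mul_assoc, ih _ ((Commute.refl _).mul_left hB),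
        ← hB.eq, Matrix.mul_assoc B, ← pow_succ']
      push_cast
      ring
  cases k with
  | zero => simp [dmat_const]
  | succ k =>
    have := h1 k 1 (Commute.one_left _)
    simpa using this

/-- The derivatives of the traces of powers of a torsion-free operator form a Lenard chain. -/
theorem trace_pow_mul_dmat {R : (ι → ℝ) → Matrix ι ι ℝ}
    (hT : ∀ x v w, torsion R R x v w = 0) (k : ℕ) (x v : ι → ℝ) :
    (R x ^ (k + 1) * dmat R x v).trace = (R x ^ k * dmat R x (R x *ᵥ v)).trace := by
  -- B is the operator w ↦ dR(w) v. Read as an operator in w, the torsion contains B only through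
  -- the commutator RB - BR, whose trace against R^k is zero.
  let B : Matrix ι ι ℝ := Matrix.of fun a c => ∑ b, dmat R x (Pi.single c 1) a b * v b
  have hB : ∀ w, dmat R x w *ᵥ v = B *ᵥ w := by
    intro w
    ext a
    simp only [Matrix.mulVec, dotProduct, B, Matrix.of_apply, dmat]
    simp only [fderiv_apply_eq_dotProduct _ x w, dotProduct, grad, Finset.sum_mul]
    rw [Finset.sum_comm]
    exact Finset.sum_congr rfl fun c _ => Finset.sum_congr rfl fun b _ => by ring
  have h : dmat R x (R x *ᵥ v) - B * R x + R x * B - R x * dmat R x v = 0 := by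
    refine Matrix.ext_of_mulVec_single fun i => ?_
    have := hT x v (Pi.single i 1)
    simp only [torsion, hB] at this
    simpa only [Matrix.sub_mulVec, Matrix.add_mulVec, ← Matrix.mulVec_mulVec,
      Matrix.zero_mulVec] using this
  have h2 := congrArg (fun M => (R x ^ k * M).trace) h
  simp only [Matrix.mul_sub, Matrix.mul_add, Matrix.trace_sub, Matrix.trace_add, mul_zero,
    Matrix.trace_zero] at h2
  have h3 : (R x ^ k * (B * R x)).trace = (R x ^ k * (R x * B)).trace := by
    rw [← Matrix.mul_assoc, Matrix.trace_mul_comm, ← Matrix.mul_assoc, ← Matrix.mul_assoc,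
      ← pow_succ, ← pow_succ']
  rw [h3, ← Matrix.mul_assoc (R x ^ k) (R x) (dmat R x v), ← pow_succ] at h2
  linarith

/-- If two functions are in involution for a constant tensor, then their Hamiltonian
fields commute. -/
theorem lieBracket_hamField_eq_zero {P : Matrix ι ι ℝ} (hP : ∀ a b, P a b = -P b a)
    {f g : (ι → ℝ) → ℝ} (hf : ContDiff ℝ ∞ f) (hg : ContDiff ℝ ∞ g)
    (h : ∀ x, bracket (fun _ => P) f g x = 0) (x : ι → ℝ) :
    VectorField.lieBracket ℝ (hamField (fun _ => P) f) (hamField (fun _ => P) g) x = 0 := by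
  have hd : ∀ {f : (ι → ℝ) → ℝ}, ContDiff ℝ ∞ f → ∀ v w,
      w ⬝ᵥ fderiv ℝ (hamField (fun _ => P) f) x v = -hess f x v (P *ᵥ w) := by
    intro f hf v w
    have e : fderiv ℝ (hamField (fun _ => P) f) x v =
        P *ᵥ fun a => fderiv ℝ (fun y => grad f y a) x v := by
      have da : DifferentiableAt ℝ (grad f) x := differentiableAt_pi.mpr fun a =>
        ((contDiff_grad hf a).differentiable (by simp)).differentiableAt
      have e1 : hamField (fun _ => P) f = (Matrix.mulVecLin P).toContinuousLinearMap ∘ grad f :=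
        rfl
      rw [e1, ((ContinuousLinearMap.hasFDerivAt _).comp x da.hasFDerivAt).fderiv]
      have e2 : fderiv ℝ (grad f) x v = fun a => fderiv ℝ (fun y => grad f y a) x v := by
        rw [show grad f = fun y a => grad f y a from rfl,
          fderiv_pi fun a => ((contDiff_grad hf a).differentiable (by simp)).differentiableAt]
        rfl
      rw [← e2]
      rfl
    rw [e, dotProduct_mulVec_skew hP, ← sum_fderiv_grad_mul hf, dotProduct_comm]
    rfl
  refine dotProduct_eq_zero_iff.mp fun w => ?_
  rw [dotProduct_comm, VectorField.lieBracket, dotProduct_sub, hd hf, hd hg]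
  -- Differentiating {f, g} = 0 in direction P w gives, by Hessian symmetry, the pairing of the Lie
  -- bracket with w.
  have := fderiv_bracket (smoothMat_const P) (fun _ => hP) hf hg x (P *ᵥ w)
  rw [show bracket (fun _ => P) f g = fun _ => 0 from funext h, dmat_const] at this
  simp only [fderiv_fun_const, Pi.zero_apply, _root_.zero_apply, Matrix.zero_mulVec,
    dotProduct_zero, add_zero] at this
  rw [hess_symm hf, hess_symm hg]
  simp only [hamField]
  linarith

/-- A map sends `J` to `π` as soon as it does so for the coordinate functions. -/
theorem mapsTensor_of_components {Φ : (ι → ℝ) → (κ → ℝ)} (hΦ : ∀ i, ContDiff ℝ ∞ fun x => Φ x i)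
    {J : (ι → ℝ) → Matrix ι ι ℝ} {π : (κ → ℝ) → Matrix κ κ ℝ}
    (h : ∀ x i j, bracket J (fun y => Φ y i) (fun y => Φ y j) x = π (Φ x) i j) :
    MapsTensor Φ J π := by
  intro F G hF hG x
  have dΦ : DifferentiableAt ℝ Φ x :=
    differentiableAt_pi.mpr fun i => ((hΦ i).differentiable (by simp)).differentiableAt
  have hg : ∀ {F : (κ → ℝ) → ℝ}, ContDiff ℝ ∞ F →
      grad (F ∘ Φ) x = ∑ i, grad F (Φ x) i • grad (fun y => Φ y i) x := by
    intro F hF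
    ext a
    have e : grad (F ∘ Φ) x a = fderiv ℝ F (Φ x) (fderiv ℝ Φ x (Pi.single a 1)) := by
      simp only [grad]
      rw [fderiv_comp x (hF.differentiable (by simp)).differentiableAt dΦ]
      rfl
    rw [e, fderiv_apply_eq_dotProduct]
    simp only [dotProduct, Finset.sum_apply, Pi.smul_apply, smul_eq_mul]
    refine Finset.sum_congr rfl fun i _ => ?_
    rw [fderiv_pi fun i => ((hΦ i).differentiable (by simp)).differentiableAt]
    rfl
  simp only [bracket] at h ⊢
  rw [hg hF, hg hG]
  simp only [Matrix.mulVec_sum, Matrix.mulVec_smul, sum_dotProduct, dotProduct_sum,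
    smul_dotProduct, dotProduct_smul, h, smul_eq_mul]
  simp only [dotProduct, Matrix.mulVec, Finset.mul_sum]
  rw [Finset.sum_comm]
  refine Finset.sum_congr rfl fun i _ => Finset.sum_congr rfl fun j _ => ?_
  ring

end Theory


/-! ### Constant vector fields behind the two brackets -/

section Lift

variable {N : ℕ}

/-- The coordinate `q_i` as a continuous linear functional. -/
def qL (i : ℕ) : Phase N →L[ℝ] ℝ :=
  if h : 1 ≤ i ∧ i ≤ N then ContinuousLinearMap.proj (Sum.inl ⟨i - 1, by omega⟩) else 0

/-- The coordinate `p_i` as a continuous linear functional. -/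
def pL (i : ℕ) : Phase N →L[ℝ] ℝ :=
  if h : 1 ≤ i ∧ i ≤ N then ContinuousLinearMap.proj (Sum.inr ⟨i - 1, by omega⟩) else 0

theorem qL_apply (i : ℕ) (x : Phase N) : qL i x = q x i := by
  unfold qL q comp
  split_ifs <;> rfl

theorem pL_apply (i : ℕ) (x : Phase N) : pL i x = p x i := by
  unfold pL p comp
  split_ifs <;> rfl

/-- The logarithm of `u_{k+1}`. -/
def ell (k : ℕ) : Phase N →L[ℝ] ℝ :=
  pL (k + 1) + (1 / 2 : ℝ) • (qL (k + 2) - qL k)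

theorem ell_apply (k : ℕ) (x : Phase N) :
    ell k x = p x (k + 1) + (1 / 2) * (q x (k + 2) - q x k) := by
  simp [ell, qL_apply, pL_apply]

theorem uu_eq_zero (x : Phase N) {i : ℕ} (h : ¬(1 ≤ i ∧ i ≤ N)) : uu x i = 0 := by
  simp [uu, comp, h]

theorem uu_zero (x : Phase N) : uu x 0 = 0 := uu_eq_zero x (by omega)

theorem uu_top (x : Phase N) : uu x (N + 1) = 0 := uu_eq_zero x (by omega)

theorem uu_succ (x : Phase N) {k : ℕ} (h : k < N) : uu x (k + 1) = Real.exp (ell k x) := by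
  rw [ell_apply, uu, comp, dif_pos (by omega)]
  simp [volterra]

theorem volterra_apply (x : Phase N) (k : Fin N) : volterra x k = uu x (k + 1) := by
  simp [uu, comp]

theorem uu_nonneg (x : Phase N) (i : ℕ) : 0 ≤ uu x i := by
  unfold uu comp volterra
  split_ifs
  · positivity
  · rfl

theorem hasFDerivAt_uu (x : Phase N) (k : ℕ) :
    HasFDerivAt (fun y : Phase N => uu y (k + 1)) (uu x (k + 1) • (ell k : Phase N →L[ℝ] ℝ)) x := by
  by_cases h : k < N
  · simp only [uu_succ _ h]
    exact (ell k).hasFDerivAt.exp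
  -- Out of range both u_{k+1} and the claimed derivative vanish, so the formula needs no bound on
  -- k.
  · simp only [uu_eq_zero _ (show ¬(1 ≤ k + 1 ∧ k + 1 ≤ N) by omega), zero_smul]
    exact hasFDerivAt_const _ _

theorem contDiff_uu (i : ℕ) : ContDiff ℝ ∞ (fun y : Phase N => uu y i) := by
  by_cases h : 1 ≤ i ∧ i ≤ N
  · obtain ⟨k, rfl⟩ : ∃ k, i = k + 1 := ⟨i - 1, by omega⟩
    simp only [uu_succ _ (show k < N by omega)]
    exact (ell k).contDiff.exp
  · simp only [uu_eq_zero _ h]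
    exact contDiff_const

/-- Spreads one u_i over all indices, so that identities linear in u can be checked on the
coefficient of each u_{k+1}. -/
theorem uu_eq_sum (x : Phase N) (i : ℕ) :
    uu x i = ∑ k ∈ Finset.range N, uu x (k + 1) * (if k + 1 = i then 1 else 0) := by
  by_cases h : 1 ≤ i ∧ i ≤ N
  · rw [Finset.sum_eq_single (i - 1)]
    · rw [show i - 1 + 1 = i by omega]; simp
    · intro b _ hb; rw [if_neg (by omega), mul_zero]
    · intro hb; exact absurd (Finset.mem_range.mpr (by omega)) hb
  · rw [uu_eq_zero x h, Finset.sum_eq_zero]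
    intro k hk
    rw [Finset.mem_range] at hk
    rw [if_neg (by omega), mul_zero]

/-- Constant vector fields, in terms of which the second structure is
`∑ u_{k+1} ξ_k ∧ ξ_{k+1}`. -/
def xi (N k : ℕ) : Phase N :=
  Sum.elim (fun j => if (j : ℕ) + 1 ≤ k then 1 else 0)
    (fun j => if (j : ℕ) = 0 then (if k ≤ 1 then -1 else -(1 / 2))
      else if (j : ℕ) + 1 = k ∨ (j : ℕ) = k then -(1 / 2) else 0)

/-- The wedge product `ξ_k ∧ ξ_{k+1}`. -/
def wedge (N k : ℕ) : Matrix (Fin N ⊕ Fin N) (Fin N ⊕ Fin N) ℝ :=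
  Matrix.vecMulVec (xi N k) (xi N (k + 1)) - Matrix.vecMulVec (xi N (k + 1)) (xi N k)

theorem qp3_eq_sum (x : Phase N) (i j : Fin N) :
    qp3 x (i + 1) (j + 1) =
      ∑ k ∈ Finset.range N, uu x (k + 1) * wedge N k (Sum.inl i) (Sum.inr j) := by
  -- Renaming u inside the sums keeps the expansion `hu` from rewriting its own right-hand side.
  obtain ⟨w, hw⟩ : ∃ w : ℕ → ℝ, ∀ k, uu x (k + 1) = w k := ⟨_, fun _ => rfl⟩
  have hu := uu_eq_sum x
  simp only [hw] at hu
  have h0 : (0 : ℝ) = ∑ k ∈ Finset.range N, w k * 0 := by simp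
  conv_rhs => simp only [hw]
  unfold qp3
  split_ifs
  all_goals
    first
    | simp only [hu, Finset.mul_sum, ← Finset.sum_add_distrib]
    | rw [h0]
  all_goals
    refine Finset.sum_congr rfl fun k _ => ?_
    simp only [wedge, Matrix.sub_apply, Matrix.vecMulVec_apply, xi, Sum.elim_inl, Sum.elim_inr]
    grind

theorem pp3_eq_sum (x : Phase N) (i j : Fin N) (h : i < j) :
    pp3 x (i + 1) (j + 1) =
      ∑ k ∈ Finset.range N, uu x (k + 1) * wedge N k (Sum.inr i) (Sum.inr j) := by
  rw [Fin.lt_def] at h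
  obtain ⟨w, hw⟩ : ∃ w : ℕ → ℝ, ∀ k, uu x (k + 1) = w k := ⟨_, fun _ => rfl⟩
  have hu := uu_eq_sum x
  simp only [hw] at hu
  have h0 : (0 : ℝ) = ∑ k ∈ Finset.range N, w k * 0 := by simp
  conv_rhs => simp only [hw]
  unfold pp3
  split_ifs
  all_goals
    first
    | simp only [hu, Finset.mul_sum, ← Finset.sum_add_distrib, ← Finset.sum_sub_distrib]
    | rw [h0]
  all_goals
    refine Finset.sum_congr rfl fun k _ => ?_
    simp only [wedge, Matrix.sub_apply, Matrix.vecMulVec_apply, xi, Sum.elim_inr]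
    grind

theorem wedge_skew (k : ℕ) (a b : Fin N ⊕ Fin N) : wedge N k a b = -wedge N k b a := by
  simp only [wedge, Matrix.sub_apply, Matrix.vecMulVec_apply]
  ring

theorem J3_eq (x : Phase N) :
    J3 x = ∑ k ∈ Finset.range N, uu x (k + 1) • wedge N k := by
  ext a b
  simp only [Matrix.sum_apply, Matrix.smul_apply, smul_eq_mul]
  rcases a with i | i <;> rcases b with j | j
  · have hu := uu_eq_sum x
    rw [J3, Matrix.fromBlocks_apply₁₁]
    simp only [skewOf, Matrix.of_apply, wedge, Matrix.sub_apply, Matrix.vecMulVec_apply, xi,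
      Sum.elim_inl, Fin.lt_def]
    generalize uu x = w at *
    split_ifs
    · rw [hu]; refine Finset.sum_congr rfl fun k _ => ?_
      grind
    · rw [hu, ← Finset.sum_neg_distrib]; refine Finset.sum_congr rfl fun k _ => ?_
      grind
    · symm; refine Finset.sum_eq_zero fun k _ => ?_
      grind
  · rw [J3, Matrix.fromBlocks_apply₁₂, Matrix.of_apply, qp3_eq_sum]
  · rw [J3, Matrix.fromBlocks_apply₂₁, Matrix.of_apply, qp3_eq_sum, ← Finset.sum_neg_distrib]
    exact Finset.sum_congr rfl fun k _ => by rw [wedge_skew k (Sum.inr i)]; ring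
  · rw [J3, Matrix.fromBlocks_apply₂₂, skewOf, Matrix.of_apply]
    split_ifs with h h'
    · exact pp3_eq_sum x i j h
    · rw [pp3_eq_sum x j i h', ← Finset.sum_neg_distrib]
      exact Finset.sum_congr rfl fun k _ => by rw [wedge_skew k (Sum.inr i)]; ring
    · obtain rfl : i = j := le_antisymm (not_lt.mp h') (not_lt.mp h)
      refine (Finset.sum_eq_zero fun k _ => ?_).symm
      rw [show wedge N k (Sum.inr i) (Sum.inr i) = 0 by linarith [wedge_skew k (Sum.inr i) (Sum.inr i)],
        mul_zero]

/-- Hence Ψ pushes ξ_d to -(u_d ∂_d + u_{d+1} ∂_{d+1}). The bound on d matters at the end of the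
chain, where q_{N+1} = 0. -/
theorem ell_xi {l d : ℕ} (hl : l < N) (hd : d ≤ N) :
    ell l (xi N d) = if d = l ∨ d = l + 1 then -1 else 0 := by
  rw [ell_apply]
  simp only [q, p, comp, xi, Sum.elim_inl, Sum.elim_inr]
  grind

theorem J2_mulVec_inl (x α : Phase N) (i : Fin N) : (J2 x *ᵥ α) (Sum.inl i) = α (Sum.inr i) := by
  simp [J2, Matrix.fromBlocks_mulVec, Function.comp_def]

theorem J2_mulVec_inr (x α : Phase N) (i : Fin N) : (J2 x *ᵥ α) (Sum.inr i) = -α (Sum.inl i) := by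
  simp [J2, Matrix.fromBlocks_mulVec, Function.comp_def, Matrix.neg_mulVec]

theorem comp_eq_sum (v : Fin N → ℝ) (i : ℕ) :
    comp v i = ∑ j : Fin N, (if (j : ℕ) + 1 = i then 1 else 0) * v j := by
  unfold comp
  split_ifs with h
  · rw [Finset.sum_eq_single ⟨i - 1, by omega⟩]
    · rw [if_pos (by simp; omega), one_mul]
    · intro b _ hb; rw [if_neg (fun h => hb (Fin.ext (by simp; omega))), zero_mul]
    · simp
  · rw [Finset.sum_eq_zero]
    intro j _
    rw [if_neg (by omega), zero_mul]

theorem ell_J2 (x α : Phase N) (k : ℕ) :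
    ell k (J2 x *ᵥ α) = xi N k ⬝ᵥ α - xi N (k + 1) ⬝ᵥ α := by
  rw [ell_apply]
  simp only [q, p, comp_eq_sum, J2_mulVec_inl, J2_mulVec_inr, dotProduct, Fintype.sum_sum_type]
  rw [← Finset.sum_sub_distrib, Finset.mul_sum, ← Finset.sum_add_distrib, add_sub_add_comm,
    ← Finset.sum_sub_distrib, ← Finset.sum_sub_distrib, ← Finset.sum_add_distrib]
  refine Finset.sum_congr rfl fun j _ => ?_
  simp only [xi, Sum.elim_inl, Sum.elim_inr]
  grind

theorem J3_mulVec (x α : Phase N) :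
    J3 x *ᵥ α = ∑ k ∈ Finset.range N, uu x (k + 1) •
      ((xi N (k + 1) ⬝ᵥ α) • xi N k - (xi N k ⬝ᵥ α) • xi N (k + 1)) := by
  rw [J3_eq, Matrix.sum_mulVec]
  refine Finset.sum_congr rfl fun k _ => ?_
  rw [Matrix.smul_mulVec, wedge, Matrix.sub_mulVec, Matrix.vecMulVec_mulVec,
    Matrix.vecMulVec_mulVec]
  simp

/-- Only the terms of J_3 with index l - 1, l, l + 1 survive. For l = 0 the truncated l - 1 is
harmless because u_0 = 0. -/
theorem ell_J3 (x α : Phase N) (l : ℕ) (hl : l < N) :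
    ell l (J3 x *ᵥ α) = uu x l * (xi N (l - 1) ⬝ᵥ α) +
      uu x (l + 1) * (xi N l ⬝ᵥ α - xi N (l + 1) ⬝ᵥ α) -
      uu x (l + 2) * (xi N (l + 2) ⬝ᵥ α) := by
  rw [J3_mulVec, map_sum]
  rw [uu_eq_sum x l, uu_eq_sum x (l + 1), uu_eq_sum x (l + 2), Finset.sum_mul, Finset.sum_mul,
    Finset.sum_mul, ← Finset.sum_add_distrib, ← Finset.sum_sub_distrib]
  refine Finset.sum_congr rfl fun k hk => ?_
  rw [Finset.mem_range] at hk
  rw [map_smul, map_sub, map_smul, map_smul, ell_xi hl hk.le, ell_xi hl hk]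
  simp only [smul_eq_mul]
  grind

end Lift


/-! ### Jacobi identities and compatibility of the pair -/

section Hierarchy

variable {N : ℕ}

theorem smoothMat_J3 : SmoothMat (J3 (N := N)) := by
  intro a b
  simp only [J3_eq, Matrix.sum_apply, Matrix.smul_apply, smul_eq_mul]
  exact ContDiff.sum fun k _ => (contDiff_uu _).mul contDiff_const

theorem J3_skew (x : Phase N) (a b : Fin N ⊕ Fin N) : J3 x a b = -J3 x b a := by
  simp only [J3_eq, Matrix.sum_apply, Matrix.smul_apply, smul_eq_mul, ← Finset.sum_neg_distrib]
  exact Finset.sum_congr rfl fun k _ => by rw [wedge_skew k a b]; ring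

theorem J2_skew (x : Phase N) (a b : Fin N ⊕ Fin N) : J2 x a b = -J2 x b a := by
  rcases a with i | i <;> rcases b with j | j <;> simp [J2, Matrix.one_apply, eq_comm]

theorem dmat_J3 (x v : Phase N) :
    dmat J3 x v = ∑ k ∈ Finset.range N, (uu x (k + 1) * ell k v) • wedge N k := by
  ext a b
  simp only [dmat, Matrix.of_apply, J3_eq, Matrix.sum_apply, Matrix.smul_apply, smul_eq_mul]
  rw [fderiv_fun_sum fun k _ => (hasFDerivAt_uu x k).differentiableAt.mul_const _,
    _root_.sum_apply]
  refine Finset.sum_congr rfl fun k _ => ?_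
  rw [((hasFDerivAt_uu x k).mul_const _).fderiv]
  simp
  ring

theorem dotProduct_wedge (k : ℕ) (γ β : Phase N) :
    γ ⬝ᵥ (wedge N k *ᵥ β) = (xi N k ⬝ᵥ γ) * (xi N (k + 1) ⬝ᵥ β) -
      (xi N (k + 1) ⬝ᵥ γ) * (xi N k ⬝ᵥ β) := by
  rw [wedge, Matrix.sub_mulVec, Matrix.vecMulVec_mulVec, Matrix.vecMulVec_mulVec, dotProduct_sub]
  simp only [op_smul_eq_smul, dotProduct_smul, smul_eq_mul]
  rw [dotProduct_comm γ, dotProduct_comm γ]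
  ring

theorem dotProduct_dmat_J3 (x v γ β : Phase N) :
    γ ⬝ᵥ (dmat J3 x v *ᵥ β) = ∑ k ∈ Finset.range N, uu x (k + 1) * ell k v *
      ((xi N k ⬝ᵥ γ) * (xi N (k + 1) ⬝ᵥ β) - (xi N (k + 1) ⬝ᵥ γ) * (xi N k ⬝ᵥ β)) := by
  rw [dmat_J3, Matrix.sum_mulVec, dotProduct_sum]
  refine Finset.sum_congr rfl fun k _ => ?_
  rw [Matrix.smul_mulVec, dotProduct_smul, dotProduct_wedge, smul_eq_mul]

theorem dmat_J3_add_smul (x v w : Phase N) (a b : ℝ) :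
    dmat J3 x (a • v + b • w) = a • dmat J3 x v + b • dmat J3 x w := by
  simp only [dmat_J3, map_add, map_smul, smul_eq_mul, Finset.smul_sum, smul_smul,
    ← Finset.sum_add_distrib, ← add_smul]
  exact Finset.sum_congr rfl fun k _ => by ring_nf

/-- Each summand is a multiple of (ξ_k - ξ_{k+1}) ∧ ξ_k ∧ ξ_{k+1} evaluated on the three covectors.
-/
theorem mixed_jacobi (x α β γ : Phase N) :
    γ ⬝ᵥ (dmat J3 x (J2 x *ᵥ α) *ᵥ β) + α ⬝ᵥ (dmat J3 x (J2 x *ᵥ β) *ᵥ γ) +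
      β ⬝ᵥ (dmat J3 x (J2 x *ᵥ γ) *ᵥ α) = 0 := by
  simp only [dotProduct_dmat_J3, ell_J2, ← Finset.sum_add_distrib]
  exact Finset.sum_eq_zero fun k _ => by ring

theorem jacobiId_J3 : JacobiId (J3 (N := N)) := by
  intro x α β γ
  simp only [dotProduct_dmat_J3, ← Finset.sum_add_distrib]
  -- D i j k is ξ_i ∧ ξ_j ∧ ξ_k on the covectors, up to sign. Its cyclic symmetry makes the two
  -- outer terms of `ell_J3` consecutive values of f, and f vanishes at both ends because u_0 =
  -- u_{N+1} = 0.
  let D (i j k : ℕ) : ℝ :=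
    (xi N i ⬝ᵥ α) * ((xi N j ⬝ᵥ γ) * (xi N k ⬝ᵥ β) - (xi N k ⬝ᵥ γ) * (xi N j ⬝ᵥ β)) +
    (xi N i ⬝ᵥ β) * ((xi N j ⬝ᵥ α) * (xi N k ⬝ᵥ γ) - (xi N k ⬝ᵥ α) * (xi N j ⬝ᵥ γ)) +
    (xi N i ⬝ᵥ γ) * ((xi N j ⬝ᵥ β) * (xi N k ⬝ᵥ α) - (xi N k ⬝ᵥ β) * (xi N j ⬝ᵥ α))
  let f (k : ℕ) : ℝ := uu x k * uu x (k + 1) * D (k - 1) k (k + 1)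
  calc _ = ∑ k ∈ Finset.range N, (f k - f (k + 1)) := by
        refine Finset.sum_congr rfl fun k hk => ?_
        simp only [ell_J3 x _ k (Finset.mem_range.mp hk), f, D, Nat.add_sub_cancel,
          show k + 1 + 1 = k + 2 from rfl]
        ring
    _ = 0 := by
        rw [Finset.sum_range_sub']
        cases N with
        | zero => simp
        | succ n => simp [f, uu_zero, uu_top]

theorem isPoisson_J2 : IsPoisson (J2 (N := N)) := by
  refine isPoisson_of_jacobiId (smoothMat_const (J2 (N := N) 0)) J2_skew fun x α β γ => ?_
  have h : ∀ v, dmat J2 x v = 0 := dmat_const (J2 0) x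
  simp [h]

theorem isPoisson_add (a b : ℝ) : IsPoisson (fun x : Phase N => a • J2 x + b • J3 x) := by
  have hs : SmoothMat (fun x : Phase N => a • J2 x + b • J3 x) := fun i j =>
    (contDiff_const (c := a * J2 (N := N) 0 i j)).add (contDiff_const.mul (smoothMat_J3 i j))
  have hd : ∀ x v : Phase N, dmat (fun x : Phase N => a • J2 x + b • J3 x) x v =
      b • dmat J3 x v := by
    intro x v
    ext i j
    simp only [dmat, Matrix.of_apply, Matrix.add_apply, Matrix.smul_apply, smul_eq_mul]
    have : HasFDerivAt (fun y : Phase N => a * J2 y i j + b * J3 y i j)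
        (b • fderiv ℝ (fun y => J3 y i j) x) x :=
      ((smoothMat_J3.differentiableAt i j x).hasFDerivAt.const_mul b).const_add (a * J2 x i j)
    rw [this.fderiv]
    rfl
  refine isPoisson_of_jacobiId hs (fun x i j => ?_) fun x α β γ => ?_
  · simp only [Matrix.add_apply, Matrix.smul_apply, smul_eq_mul, J2_skew x i j, J3_skew x i j]
    ring
  · have h1 := mixed_jacobi x α β γ
    have h2 := jacobiId_J3 x α β γ
    simp only [hd, Matrix.add_mulVec, Matrix.smul_mulVec, dmat_J3_add_smul, dotProduct_add,
      dotProduct_smul, smul_eq_mul]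
    linear_combination b * a * h1 + b * b * h2

theorem isPoisson_J3 : IsPoisson (J3 (N := N)) := by
  simpa using isPoisson_add (N := N) 0 1

/-! ### The recursion operator -/

/-- The inverse of the canonical tensor. -/
def J2inv (N : ℕ) : Matrix (Fin N ⊕ Fin N) (Fin N ⊕ Fin N) ℝ :=
  Matrix.fromBlocks 0 (-1) 1 0

theorem J2inv_mul (x : Phase N) : J2inv N * J2 x = 1 := by
  simp [J2inv, J2, Matrix.fromBlocks_multiply, Matrix.fromBlocks_one]

theorem J2_mul_inv (x : Phase N) : J2 x * J2inv N = 1 :=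
  mul_eq_one_comm.mp (J2inv_mul x)

theorem J2inv_transpose : (J2inv N)ᵀ = -J2inv N := by
  simp [J2inv, Matrix.fromBlocks_transpose, Matrix.fromBlocks_neg]

theorem recOp_eq (x : Phase N) : recOp x = J3 x * J2inv N := by
  rw [recOp, Matrix.inv_eq_left_inv (J2inv_mul x)]

theorem recOp_mul_J2 (x : Phase N) : recOp x * J2 x = J3 x := by
  rw [recOp_eq, Matrix.mul_assoc, J2inv_mul, mul_one]

theorem smoothMat_recOp : SmoothMat (recOp (N := N)) := by
  rw [show recOp (N := N) = fun x => J3 x * J2inv N from funext recOp_eq]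
  exact smoothMat_J3.mul (smoothMat_const _)

theorem recOp_symm (x : Phase N) : J2inv N * recOp x = (recOp x)ᵀ * J2inv N := by
  have h : (J3 x)ᵀ = -J3 x := by ext a b; simpa using J3_skew x b a
  rw [recOp_eq, Matrix.transpose_mul, J2inv_transpose, h, neg_mul_neg, Matrix.mul_assoc]

/-- This is the mixed Jacobi identity evaluated on the covectors K a, K b, K c, with K the inverse
of J_2. -/
theorem closedForm_recOp : ClosedForm (J2inv N) recOp := by
  intro x a b c
  rw [show recOp (N := N) = fun x => J3 x * J2inv N from funext recOp_eq]
  have h := mixed_jacobi x (J2inv N *ᵥ a) (J2inv N *ᵥ b) (J2inv N *ᵥ c)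
  have e : ∀ v : Phase N, J2 x *ᵥ (J2inv N *ᵥ v) = v := fun v => by
    rw [Matrix.mulVec_mulVec, J2_mul_inv, Matrix.one_mulVec]
  simpa only [dmat_mul_const smoothMat_J3, ← Matrix.mulVec_mulVec, e] using h

theorem torsion_recOp (x v w : Phase N) : torsion recOp recOp x v w = 0 := by
  refine torsion_eq_zero_of_jacobiId J2inv_transpose (J2inv_mul 0) smoothMat_recOp recOp_symm
    closedForm_recOp ?_ x v w
  rw [show (fun y => recOp y * J2 (N := N) 0) = J3 from funext recOp_mul_J2]
  exact jacobiId_J3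

theorem isPoisson_tensorJ (i : ℕ) : IsPoisson (tensorJ (N := N) i) :=
  isPoisson_pow_mul J2inv_transpose (J2inv_mul 0) smoothMat_recOp recOp_symm closedForm_recOp
    torsion_recOp (i - 2)

/-! The map to the KM-system -/

theorem contDiff_volterra (i : Fin N) : ContDiff ℝ ∞ fun x : Phase N => volterra x i := by
  simp only [volterra_apply]
  exact contDiff_uu _

theorem grad_volterra_dotProduct (x v : Phase N) (i : Fin N) :
    v ⬝ᵥ grad (fun y => volterra y i) x = volterra x i * ell i v := by
  rw [dotProduct_comm, ← fderiv_apply_eq_dotProduct]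
  simp only [volterra_apply]
  rw [(hasFDerivAt_uu x i).fderiv]
  rfl

theorem mapsTensor_J2 : MapsTensor (volterra (N := N)) J2 pi2 := by
  refine mapsTensor_of_components contDiff_volterra fun x i j => ?_
  rw [bracket, dotProduct_comm, grad_volterra_dotProduct, ell_J2, grad_volterra_dotProduct,
    grad_volterra_dotProduct, ell_xi j.2 i.2.le, ell_xi j.2 i.2]
  have hu : ∀ k, comp (volterra x) k = uu x k := fun _ => rfl
  simp only [pi2, skewOf, Matrix.of_apply, volterra_apply, hu, Fin.lt_def]
  grind

theorem mapsTensor_J3 : MapsTensor (volterra (N := N)) J3 pi3 := by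
  refine mapsTensor_of_components contDiff_volterra fun x i j => ?_
  have hu : ∀ k, comp (volterra x) k = uu x k := fun _ => rfl
  have h0 := uu_zero x
  have h1 := uu_top x
  have hx : ∀ k ≤ N, xi N k ⬝ᵥ grad (fun y => volterra y j) x =
      uu x (j + 1) * (if k = j ∨ k = j + 1 then -1 else 0) := fun k hk => by
    rw [grad_volterra_dotProduct, ell_xi j.2 hk, volterra_apply]
  rw [bracket, dotProduct_comm, grad_volterra_dotProduct, ell_J3 _ _ _ i.2, hx _ (by omega),
    hx _ i.2.le, hx _ i.2]
  -- The index i + 2 may exceed N, where `hx` does not apply; there the coefficient u_{i+2} is zero.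
  have h2 : uu x (i + 2) * (xi N (i + 2) ⬝ᵥ grad (fun y => volterra y j) x) =
      uu x (i + 2) * (uu x (j + 1) * (if (i : ℕ) + 2 = j ∨ (i : ℕ) + 2 = j + 1 then -1 else 0)) := by
    by_cases h : (i : ℕ) + 2 ≤ N
    · rw [hx _ h]
    · rw [uu_eq_zero x (show ¬(1 ≤ (i : ℕ) + 2 ∧ (i : ℕ) + 2 ≤ N) by omega), zero_mul, zero_mul]
  rw [h2]
  simp only [pi3, skewOf, Matrix.of_apply, volterra_apply, hu, Fin.lt_def]
  have hi := i.2
  have hj := j.2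
  generalize uu x = w at *
  generalize (i : ℕ) = i at *
  generalize (j : ℕ) = j at *
  grind

/-! The Hamiltonians -/

theorem h1_eq (x : Phase N) : h1 x = ∑ k ∈ Finset.range N, uu x (k + 1) := by
  rw [h1, show Finset.Icc 1 N = Finset.Ico 1 (N + 1) from rfl, Finset.sum_Ico_eq_sum_range]
  refine Finset.sum_congr rfl fun k hk => ?_
  rw [uu_succ x (by simpa using hk), ell_apply, add_comm 1 k]
  rfl

theorem h2_eq (x : Phase N) : h2 x = ∑ k ∈ Finset.range N,
    ((1 / 2) * uu x (k + 1) ^ 2 + uu x (k + 1) * uu x (k + 2)) := by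
  have e1 : ∑ i ∈ Finset.Icc 1 N, Real.exp (2 * p x i + q x (i + 1) - q x (i - 1)) =
      ∑ k ∈ Finset.range N, uu x (k + 1) ^ 2 := by
    rw [show Finset.Icc 1 N = Finset.Ico 1 (N + 1) from rfl, Finset.sum_Ico_eq_sum_range]
    refine Finset.sum_congr rfl fun k hk => ?_
    rw [uu_succ x (by simpa using hk), ell_apply, ← Real.exp_nat_mul, add_comm 1 k]
    congr 1
    push_cast
    simp
    ring_nf
  have e2 : ∑ i ∈ Finset.Icc 1 (N - 1), Real.exp (p x i + p x (i + 1) +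
      (1 / 2) * (q x (i + 2) + q x (i + 1) - q x i - q x (i - 1))) =
      ∑ k ∈ Finset.range N, uu x (k + 1) * uu x (k + 2) := by
    cases N with
    | zero => simp
    | succ n =>
      rw [Finset.sum_range_succ, uu_eq_zero x (i := n + 2) (by omega), mul_zero, add_zero,
        Nat.add_sub_cancel, show Finset.Icc 1 n = Finset.Ico 1 (n + 1) from rfl,
        Finset.sum_Ico_eq_sum_range]
      refine Finset.sum_congr rfl fun k hk => ?_
      rw [Finset.mem_range] at hk
      rw [uu_succ x (show k < n + 1 by omega), uu_succ x (show k + 1 < n + 1 by omega),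
        ell_apply, ell_apply, ← Real.exp_add, add_comm 1 k]
      congr 1
      simp only [Nat.add_sub_cancel]
      ring_nf
  rw [h2, e1, e2, Finset.mul_sum, ← Finset.sum_add_distrib]

theorem hasFDerivAt_h1 (x : Phase N) :
    HasFDerivAt h1 (∑ k ∈ Finset.range N, uu x (k + 1) • (ell k : Phase N →L[ℝ] ℝ)) x := by
  rw [show h1 (N := N) = fun x => ∑ k ∈ Finset.range N, uu x (k + 1) from funext h1_eq]
  exact HasFDerivAt.fun_sum fun k _ => hasFDerivAt_uu x k

theorem fderiv_h2 (x v : Phase N) :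
    fderiv ℝ h2 x v = ∑ k ∈ Finset.range N,
      (uu x (k + 1) ^ 2 * ell k v + uu x (k + 1) * uu x (k + 2) * (ell k v + ell (k + 1) v)) := by
  rw [show h2 (N := N) = _ from funext h2_eq]
  have h : HasFDerivAt (fun y : Phase N => ∑ k ∈ Finset.range N,
      ((1 / 2) * uu y (k + 1) ^ 2 + uu y (k + 1) * uu y (k + 2))) _ x :=
    HasFDerivAt.fun_sum fun k _ => (((hasFDerivAt_uu x k).pow 2).const_mul (1 / 2)).add
      ((hasFDerivAt_uu x k).mul (hasFDerivAt_uu x (k + 1)))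
  rw [h.fderiv, _root_.sum_apply]
  refine Finset.sum_congr rfl fun k _ => ?_
  simp only [_root_.add_apply, _root_.smul_apply, smul_eq_mul, nsmul_eq_mul]
  push_cast
  ring

theorem contDiff_h2 : ContDiff ℝ ∞ (h2 (N := N)) := by
  rw [show h2 (N := N) = _ from funext h2_eq]
  exact ContDiff.sum fun k _ =>
    (contDiff_const.mul ((contDiff_uu _).pow 2)).add ((contDiff_uu _).mul (contDiff_uu _))

theorem dotProduct_hamField {J : Phase N → Matrix (Fin N ⊕ Fin N) (Fin N ⊕ Fin N) ℝ}
    (hJ : ∀ x a b, J x a b = -J x b a) (f : Phase N → ℝ) (x α : Phase N) :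
    α ⬝ᵥ hamField J f x = -fderiv ℝ f x (J x *ᵥ α) := by
  rw [hamField, dotProduct_mulVec_skew (hJ x), dotProduct_comm, ← fderiv_apply_eq_dotProduct]

theorem hamField_J2_h2 (x : Phase N) : hamField J2 h2 x = hamField J3 h1 x := by
  refine dotProduct_eq_iff.mp fun α => ?_
  rw [dotProduct_comm, dotProduct_comm (hamField J3 h1 x), dotProduct_hamField J2_skew,
    dotProduct_hamField J3_skew, fderiv_h2, (hasFDerivAt_h1 x).fderiv, neg_inj, _root_.sum_apply]
  simp only [_root_.smul_apply, smul_eq_mul, ell_J2]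
  -- The two derivatives differ by f(k+1) - f(k) in each summand, and f(0) = f(N) = 0.
  let f (k : ℕ) : ℝ := uu x k * uu x (k + 1) * (xi N (k - 1) ⬝ᵥ α)
  rw [← sub_eq_zero, ← Finset.sum_sub_distrib]
  calc _ = ∑ k ∈ Finset.range N, (f (k + 1) - f k) := by
        refine Finset.sum_congr rfl fun k hk => ?_
        rw [ell_J3 x _ k (Finset.mem_range.mp hk)]
        simp only [f, Nat.add_sub_cancel, show k + 1 + 1 = k + 2 from rfl]
        ring
    _ = 0 := by
        rw [Finset.sum_range_sub]
        simp [f, uu_zero, uu_top]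

theorem h1_eq_traceH (x : Phase N) : h1 x = (1 / 2) * traceH 1 (volterra x) := by
  have hu : ∀ k, comp (volterra x) k = uu x k := fun _ => rfl
  rw [h1_eq, traceH, pow_one]
  simp only [Matrix.trace, Matrix.diag, lax, Matrix.of_apply, if_true, hu]
  rw [Fin.sum_univ_eq_sum_range (fun i => uu x i + uu x (i + 1)), Finset.sum_add_distrib,
    Finset.sum_range_succ', Finset.sum_range_succ (fun i => uu x (i + 1)), uu_zero, uu_top]
  ring

theorem h2_eq_traceH (x : Phase N) : h2 x = (1 / 2) * traceH 2 (volterra x) := by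
  have hu : ∀ k, comp (volterra x) k = uu x k := fun _ => rfl
  have hrow : ∀ i j : Fin (N + 1), lax (volterra x) i j * lax (volterra x) j i =
      (if j = i then (uu x i + uu x (i + 1)) ^ 2 else 0) +
      ((if (j : ℕ) = i + 2 then uu x (i + 1) * uu x (i + 2) else 0) +
      (if (i : ℕ) = j + 2 then uu x (j + 1) * uu x (j + 2) else 0)) := by
    intro i j
    have hs : ∀ k, √(uu x (k + 1) * uu x (k + 2)) * √(uu x (k + 1) * uu x (k + 2)) =
        uu x (k + 1) * uu x (k + 2) := fun k =>
      Real.mul_self_sqrt (mul_nonneg (uu_nonneg x _) (uu_nonneg x _))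
    have hi := hs i
    have hj := hs j
    simp only [lax, Matrix.of_apply, hu, Fin.ext_iff]
    grind
  have hshift : ∀ i : Fin (N + 1), ∑ j : Fin (N + 1),
      (if (j : ℕ) = i + 2 then uu x (i + 1) * uu x (i + 2) else 0) =
      uu x (i + 1) * uu x (i + 2) := by
    intro i
    by_cases h : (i : ℕ) + 2 ≤ N
    · rw [Finset.sum_eq_single ⟨i + 2, by omega⟩]
      · simp
      · intro b _ hb
        rw [if_neg fun h => hb (Fin.ext h)]
      · simp
    · rw [uu_eq_zero x (i := i + 2) (by omega)]
      simp
  have htr : (lax (volterra x) ^ 2).trace = ∑ i ∈ Finset.range (N + 1),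
      ((uu x i + uu x (i + 1)) ^ 2 + 2 * (uu x (i + 1) * uu x (i + 2))) := by
    rw [← Fin.sum_univ_eq_sum_range
      (fun i => (uu x i + uu x (i + 1)) ^ 2 + 2 * (uu x (i + 1) * uu x (i + 2)))]
    simp only [Matrix.trace, Matrix.diag, pow_two (lax _), Matrix.mul_apply, hrow,
      Finset.sum_add_distrib]
    rw [Finset.sum_comm (f := fun i j : Fin (N + 1) => if (i : ℕ) = j + 2 then _ else _)]
    simp only [hshift, Finset.sum_ite_eq', Finset.mem_univ, if_true, ← Finset.mul_sum]
    ring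
  have e1 : ∑ i ∈ Finset.range (N + 1), uu x i ^ 2 = ∑ i ∈ Finset.range N, uu x (i + 1) ^ 2 := by
    rw [Finset.sum_range_succ', uu_zero]; simp
  have e2 : ∑ i ∈ Finset.range (N + 1), uu x (i + 1) ^ 2 =
      ∑ i ∈ Finset.range N, uu x (i + 1) ^ 2 := by
    rw [Finset.sum_range_succ, uu_top]; simp
  have e3 : ∑ i ∈ Finset.range (N + 1), uu x i * uu x (i + 1) =
      ∑ i ∈ Finset.range N, uu x (i + 1) * uu x (i + 2) := by
    rw [Finset.sum_range_succ', uu_zero]; simp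
  have e4 : ∑ i ∈ Finset.range (N + 1), uu x (i + 1) * uu x (i + 2) =
      ∑ i ∈ Finset.range N, uu x (i + 1) * uu x (i + 2) := by
    rw [Finset.sum_range_succ, uu_top]; simp
  rw [h2_eq, traceH, htr]
  have : ∀ i, (uu x i + uu x (i + 1)) ^ 2 + 2 * (uu x (i + 1) * uu x (i + 2)) =
      uu x i ^ 2 + uu x (i + 1) ^ 2 + 2 * (uu x i * uu x (i + 1)) +
        2 * (uu x (i + 1) * uu x (i + 2)) := fun i => by ring
  simp only [this, Finset.sum_add_distrib, ← Finset.mul_sum, e1, e2, e3, e4]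
  push_cast
  ring

theorem trace_recOp (x : Phase N) : (recOp x).trace = 2 * h1 x := by
  rw [recOp_eq, J3, J2inv, Matrix.fromBlocks_multiply, h1_eq]
  have e : ∑ i : Fin N, qp3 x (i + 1) (i + 1) = ∑ k ∈ Finset.range N, uu x (k + 1) := by
    rw [Fin.sum_univ_eq_sum_range (fun i => qp3 x (i + 1) (i + 1)), ← sub_eq_zero,
      ← Finset.sum_sub_distrib]
    -- The excess of {q_i, p_i} over u_i telescopes. The exceptional {q_1, p_1} = u_1 + u_2/2 forces
    -- the value 0 at k = 0.
    let f (k : ℕ) : ℝ := if k = 0 then 0 else 1 / 2 * uu x (k + 1)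
    calc _ = ∑ k ∈ Finset.range N, (f (k + 1) - f k) := by
          refine Finset.sum_congr rfl fun k _ => ?_
          simp only [qp3, f]
          grind
      _ = 0 := by
          rw [Finset.sum_range_sub]
          simp [f, uu_top]
  simp [Matrix.trace, Matrix.diag, e]
  ring

/-! The hierarchy -/

/-- The normalized traces of the powers of the recursion operator. -/
def traceR (j : ℕ) (x : Phase N) : ℝ := (1 / (2 * (j : ℝ))) * (recOp x ^ j).trace

theorem contDiff_traceR (j : ℕ) : ContDiff ℝ ∞ (traceR (N := N) j) := by
  unfold traceR
  simp only [Matrix.trace, Matrix.diag]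
  exact contDiff_const.mul (ContDiff.sum fun a _ => smoothMat_recOp.pow j a a)

theorem traceR_one : traceR (N := N) 1 = h1 := by
  ext x
  simp [traceR, trace_recOp]

theorem fderiv_traceR (j : ℕ) (x v : Phase N) :
    fderiv ℝ (traceR (j + 1)) x v = (1 / 2) * (recOp x ^ j * dmat recOp x v).trace := by
  have hd : DifferentiableAt ℝ (fun y : Phase N => (recOp y ^ (j + 1)).trace) x := by
    simp only [Matrix.trace, Matrix.diag]
    exact DifferentiableAt.fun_sum fun a _ => (smoothMat_recOp.pow (j + 1)).differentiableAt a a x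
  unfold traceR
  rw [fderiv_const_mul hd, _root_.smul_apply, smul_eq_mul, fderiv_trace_pow smoothMat_recOp,
    Nat.add_sub_cancel]
  push_cast
  have : (j : ℝ) + 1 ≠ 0 := by positivity
  field_simp

/-- Tested on a covector, this is the trace identity for R along J_2 α, since R J_2 = J_3. -/
theorem hamField_traceR_succ (j : ℕ) (x : Phase N) :
    hamField J2 (traceR (j + 2)) x = recOp x *ᵥ hamField J2 (traceR (j + 1)) x := by
  have h : recOp x *ᵥ hamField J2 (traceR (j + 1)) x = hamField J3 (traceR (j + 1)) x := by
    simp only [hamField, Matrix.mulVec_mulVec, recOp_mul_J2]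
  rw [h]
  refine dotProduct_eq_iff.mp fun α => ?_
  rw [dotProduct_comm, dotProduct_comm (hamField J3 _ x), dotProduct_hamField J2_skew,
    dotProduct_hamField J3_skew, fderiv_traceR, fderiv_traceR, trace_pow_mul_dmat torsion_recOp,
    Matrix.mulVec_mulVec, recOp_mul_J2]

theorem fieldX_succ_eq (j : ℕ) (x : Phase N) :
    fieldX (j + 1) x = hamField J2 (traceR (j + 1)) x := by
  induction j with
  | zero => simp [fieldX, traceR_one]
  | succ j ih =>
    rw [hamField_traceR_succ, ← ih]
    simp only [fieldX, Nat.add_sub_cancel, Matrix.mulVec_mulVec, pow_succ']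

/-- The Hamiltonians of the hierarchy. -/
def hamiltonian (j : ℕ) : Phase N → ℝ := if j = 2 then h2 else traceR j

theorem contDiff_hamiltonian (j : ℕ) : ContDiff ℝ ∞ (hamiltonian (N := N) j) := by
  unfold hamiltonian
  split_ifs
  · exact contDiff_h2
  · exact contDiff_traceR j

/-- The prescribed h_2 is used as it stands: J_2 ∇h_2 = J_3 ∇h_1 already gives X_2, so no comparison
with Tr R^2 is needed. -/
theorem fieldX_eq {j : ℕ} (hj : 1 ≤ j) (x : Phase N) :
    fieldX j x = hamField J2 (hamiltonian j) x := by
  obtain ⟨j, rfl⟩ : ∃ k, j = k + 1 := ⟨j - 1, by omega⟩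
  unfold hamiltonian
  split_ifs with h
  · rw [h, hamField_J2_h2]
    simp only [fieldX, hamField, Matrix.mulVec_mulVec, Nat.reduceSub, pow_one, recOp_mul_J2]
  · exact fieldX_succ_eq j x

theorem hamField_tensorJ {i j : ℕ} (hi : 2 ≤ i) (hj : 1 ≤ j) (x : Phase N) :
    hamField (tensorJ i) (hamiltonian j) x = fieldX (i + j - 2) x := by
  have h := fieldX_eq hj x
  simp only [hamField] at h
  rw [hamField, tensorJ, ← Matrix.mulVec_mulVec, ← h, fieldX, fieldX, Matrix.mulVec_mulVec,
    ← pow_add]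
  congr 3
  omega

/-- The bracket is K X_i paired with X_{k+j-2}. Moving all powers of R to one side leaves K R^m X_1
paired with X_1, which vanishes because K is skew and R is self-adjoint for K. -/
theorem bracket_tensorJ {i j k : ℕ} (hi : 1 ≤ i) (hj : 1 ≤ j) (hk : 2 ≤ k) (x : Phase N) :
    bracket (tensorJ k) (hamiltonian i) (hamiltonian j) x = 0 := by
  have e1 : grad (hamiltonian i) x = J2inv N *ᵥ fieldX i x := by
    rw [fieldX_eq hi, hamField, Matrix.mulVec_mulVec, J2inv_mul, Matrix.one_mulVec]
  have e2 := hamField_tensorJ hk hj x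
  rw [hamField] at e2
  rw [bracket, e2, e1, fieldX, fieldX]
  generalize hamField J2 h1 x = X
  have sk : ∀ m, J2inv N * recOp x ^ m = (recOp x ^ m)ᵀ * J2inv N := fun m => by
    rw [Matrix.transpose_pow]
    exact (SemiconjBy.pow_right
      (show SemiconjBy (J2inv N) (recOp x) (recOp x)ᵀ from recOp_symm x) m)
  rw [form_symm (sk _), Matrix.mulVec_mulVec X, ← pow_add]
  have h := form_antisymm J2inv_transpose (recOp x ^ (k + j - 2 - 1 + (i - 1)) *ᵥ X) X
  have h' := form_symm (sk (k + j - 2 - 1 + (i - 1))) X X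
  linarith

theorem lieBracket_fieldX {i j : ℕ} (hi : 1 ≤ i) (hj : 1 ≤ j) (x : Phase N) :
    VectorField.lieBracket ℝ (fieldX i) (fieldX j) x = 0 := by
  rw [show fieldX (N := N) i = hamField (fun _ => J2 0) (hamiltonian i) from
      funext fun x => fieldX_eq hi x,
    show fieldX (N := N) j = hamField (fun _ => J2 0) (hamiltonian j) from
      funext fun x => fieldX_eq hj x]
  refine lieBracket_hamField_eq_zero (J2_skew 0) (contDiff_hamiltonian i) (contDiff_hamiltonian j)
    (fun x => ?_) x
  have h := bracket_tensorJ hi hj le_rfl x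
  rwa [show tensorJ (N := N) 2 = J2 from funext fun x => by simp [tensorJ]] at h

end Hierarchy

end VolterraKM

end

open VolterraKM in
theorem mainTheorem2 (n : ℕ) (hn : 1 ≤ n) :
    -- the symplectic pair lifts the bi-Hamiltonian pair of the KM-system
    IsSymplectic (J2 (N := 2 * n - 1)) ∧
    IsPoisson (J3 (N := 2 * n - 1)) ∧
    Compatible (J2 (N := 2 * n - 1)) J3 ∧
    MapsTensor (volterra (N := 2 * n - 1)) J2 pi2 ∧
    MapsTensor (volterra (N := 2 * n - 1)) J3 pi3 ∧
    (∀ x : Phase (2 * n - 1), h1 x = (1 / 2) * traceH 1 (volterra x)) ∧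
    (∀ x : Phase (2 * n - 1), h2 x = (1 / 2) * traceH 2 (volterra x)) ∧
    (∀ x : Phase (2 * n - 1), hamField J2 h2 x = hamField J3 h1 x) ∧
    -- the hierarchy
    (∀ i, 2 ≤ i → IsPoisson (tensorJ (N := 2 * n - 1) i)) ∧
    (∀ i j, 1 ≤ i → 1 ≤ j → ∀ x : Phase (2 * n - 1),
      VectorField.lieBracket ℝ (fieldX i) (fieldX j) x = 0) ∧
    ∃ h : ℕ → Phase (2 * n - 1) → ℝ,
      h 1 = h1 ∧ h 2 = h2 ∧ (∀ j, 1 ≤ j → ContDiff ℝ ∞ (h j)) ∧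
      (∀ j, 1 ≤ j → ∀ x, fieldX j x = hamField J2 (h j) x) ∧
      (∀ i j, 2 ≤ i → 1 ≤ j → ∀ x, hamField (tensorJ i) (h j) x = fieldX (i + j - 2) x) ∧
      (∀ i j k, 1 ≤ i → 1 ≤ j → 2 ≤ k → ∀ x, bracket (tensorJ k) (h i) (h j) x = 0) :=
  ⟨⟨isPoisson_J2, fun x => IsUnit.of_mul_eq_one _ (J2_mul_inv x)⟩, isPoisson_J3, isPoisson_add,
    mapsTensor_J2, mapsTensor_J3, h1_eq_traceH, h2_eq_traceH, hamField_J2_h2,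
    fun i _ => isPoisson_tensorJ i, fun _ _ hi hj => lieBracket_fieldX hi hj,
    hamiltonian, traceR_one, rfl, fun j _ => contDiff_hamiltonian j, fun _ hj => fieldX_eq hj,
    fun _ _ hi hj => hamField_tensorJ hi hj, fun _ _ _ hi hj hk => bracket_tensorJ hi hj hk⟩
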